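/- Theorem (real-analytic CR functions). Let $M\subset\mathbb{C}^{n+c}$ be an (embedded) real-analytic real submanifold of real codimension $c$, i.e. near each of its points $M$ is the common zero set of $c$ real-analytic real-valued functions with linearly independent differentials. Let $J$ denote the standard complex structure of $\mathbb{C}^{n+c}$ and assume that $M$ is CR-generic, i.e. $T_qM+J(T_qM)=T_q\mathbb{C}^{n+c}$ for every $q\in M$ (so that $\dim_{\mathbb R}M=2n+c$ and $M$ has CR dimension $n$). Put $$T^{0,1}_qM := T^{0,1}_q\mathbb{C}^{n+c}\cap(\mathbb{C}\otimes_{\mathbb{R}}T_qM),\qquad T^{0,1}_q\mathbb{C}^{n+c}=\{X+\sqrt{-1}\,J(X): X\in T_q\mathbb{C}^{n+c}\}.$$ Let $f:M\to\mathbb{C}$ be a real-analytic function. Then $f$ is Cauchy-Riemann, i.e. $\overline{\mathcal L}(f)\equiv 0$ for every local real-analytic section $\overline{\mathcal L}$ of $T^{0,1}M$ over an open subset of $M$, if and only if there are an open neighborhood $U$ of $M$ in $\mathbb{C}^{n+c}$ and a holomorphic function $F:U\to\mathbb{C}$ with $F|_M=f$. -/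

import Mathlib

open scoped TensorProduct Topology

/-- The complex Euclidean space `ℂ^N` (only its topology and its real and complex linear structure
matter here). -/
abbrev CSpace (N : ℕ) : Type := Fin N → ℂ

/-- `M ⊆ ℂ^N` is a real-analytic (embedded) real submanifold of real codimension `c`: near each of
its points it is the common zero set of `c` real-analytic functions whose differentials are
linearly independent. -/
def IsAnalyticSubmanifold {N : ℕ} (c : ℕ) (M : Set (CSpace N)) : Prop :=
  ∀ p ∈ M, ∃ U : Set (CSpace N), IsOpen U ∧ p ∈ U ∧
    ∃ r : Fin c → CSpace N → ℝ,
      (∀ j, AnalyticOnNhd ℝ (r j) U) ∧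
      M ∩ U = {q ∈ U | ∀ j, r j q = 0} ∧
      ∀ q ∈ U, LinearIndependent ℝ (fun j => fderiv ℝ (r j) q)

/-- The real tangent space `T_q M ⊆ T_q ℂ^N = ℂ^N`: the velocities at `q` of curves drawn on `M`.
(For a submanifold these velocities already form a real vector space, so that taking the span adds
nothing.) -/
noncomputable def realTangent {N : ℕ} (M : Set (CSpace N)) (q : CSpace N) : Submodule ℝ (CSpace N) :=
  Submodule.span ℝ
    {v | ∃ γ : ℝ → CSpace N, γ 0 = q ∧ (∀ᶠ t in 𝓝 (0 : ℝ), γ t ∈ M) ∧ HasDerivAt γ v 0}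

/-- The complex structure `J` of `ℂ^N`, `J (∂/∂x_k) = ∂/∂y_k`, `J (∂/∂y_k) = - ∂/∂x_k`. -/
noncomputable def complexStructure (N : ℕ) : CSpace N →ₗ[ℝ] CSpace N :=
  (LinearMap.lsmul ℂ (CSpace N) Complex.I).restrictScalars ℝ

/-- `M` is CR-generic: `T_q M + J (T_q M) = T_q ℂ^N` at every point `q` of `M`. -/
def IsCRGeneric {N : ℕ} (M : Set (CSpace N)) : Prop :=
  ∀ q ∈ M, realTangent M q ⊔ (realTangent M q).map (complexStructure N) = ⊤

/-- The complex tangent vector `X + √-1 J(X)`, an element of `ℂ ⊗_ℝ T_q ℂ^N`. -/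
noncomputable def antiholVector {N : ℕ} (X : CSpace N) : ℂ ⊗[ℝ] CSpace N :=
  (1 : ℂ) ⊗ₜ[ℝ] X + Complex.I ⊗ₜ[ℝ] complexStructure N X

/-- The space `T^{0,1}_q ℂ^N = {X + √-1 J(X) : X ∈ T_q ℂ^N}` of antiholomorphic tangent vectors, a
complex subspace of `ℂ ⊗_ℝ T_q ℂ^N`. -/
noncomputable def ambientT01 (N : ℕ) : Submodule ℂ (ℂ ⊗[ℝ] CSpace N) where
  carrier := Set.range antiholVector
  zero_mem' := ⟨0, by simp [antiholVector]⟩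
  add_mem' := by
    rintro _ _ ⟨X, rfl⟩ ⟨Y, rfl⟩
    refine ⟨X + Y, ?_⟩
    simp only [antiholVector, map_add, TensorProduct.tmul_add]
    abel
  smul_mem' := by
    rintro a _ ⟨X, rfl⟩
    refine ⟨a.re • X - a.im • complexStructure N X, ?_⟩
    have hJ : complexStructure N (complexStructure N X) = -X := by
      simp [complexStructure, smul_smul]
    have h1 : a = a.re • (1 : ℂ) + a.im • Complex.I := by
      simp [Complex.re_add_im]
    have h2 : a * Complex.I = a.re • Complex.I - a.im • (1 : ℂ) := by
      apply Complex.ext <;> simp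
    simp only [antiholVector, smul_add, TensorProduct.smul_tmul', smul_eq_mul, mul_one]
    rw [h2]
    conv_rhs => enter [1, 2]; rw [h1]
    simp only [map_sub, map_smul, hJ, TensorProduct.tmul_sub, TensorProduct.tmul_smul,
      TensorProduct.add_tmul, TensorProduct.sub_tmul, TensorProduct.smul_tmul', smul_neg,
      TensorProduct.tmul_neg]
    abel

/-- `T^{0,1}_q M = T^{0,1}_q ℂ^N ∩ (ℂ ⊗_ℝ T_q M)`. -/
noncomputable def fiberT01 {N : ℕ} (M : Set (CSpace N)) (q : CSpace N) : Submodule ℂ (ℂ ⊗[ℝ] CSpace N) :=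
  ambientT01 N ⊓ (realTangent M q).baseChange ℂ

/-- `L` is a (real-analytic) local section of `T^{0,1}M` over the open subset `M ∩ V` of `M`, that
is, `L = P + √-1 Q` for two real-analytic real vector fields `P`, `Q` along `M ∩ V`, and
`L q ∈ T^{0,1}_q M` for every `q`.  Here and below `AnalyticOn ℝ g S` says that near each point of
`S` the function `g` coincides on `S` with the sum of a converging power series in the real
coordinates of `ℂ^N`; only the values of `g` on `S` matter. -/
def IsLocalSectionT01 {N : ℕ} (M V : Set (CSpace N)) (L : CSpace N → ℂ ⊗[ℝ] CSpace N) : Prop :=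
  (∃ P Q : CSpace N → CSpace N,
    AnalyticOn ℝ P (M ∩ V) ∧ AnalyticOn ℝ Q (M ∩ V) ∧
      ∀ q ∈ M ∩ V, L q = (1 : ℂ) ⊗ₜ[ℝ] P q + Complex.I ⊗ₜ[ℝ] Q q) ∧
  ∀ q ∈ M ∩ V, L q ∈ fiberT01 M q

/-- The derivative `ξ(f)` at `q` of a function `f` on `M` along `ξ ∈ ℂ ⊗_ℝ T_q M`: the
differential of `f` along `M` at `q`, extended to be complex linear, evaluated at `ξ`.  (For
differentiable `f` its values on `ℂ ⊗_ℝ T_q M` are determined by the restriction of `f` to `M`.) -/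
noncomputable def derivAlong {N : ℕ} (M : Set (CSpace N)) (f : CSpace N → ℂ) (q : CSpace N)
    (ξ : ℂ ⊗[ℝ] CSpace N) : ℂ :=
  LinearMap.liftBaseChange ℂ (fderivWithin ℝ f M q : CSpace N →ₗ[ℝ] ℂ) ξ

/-- The (real-analytic) function `f` on `M` is Cauchy-Riemann: it is annihilated by every local
section of `T^{0,1}M`. -/
def IsCRFunction {N : ℕ} (M : Set (CSpace N)) (f : CSpace N → ℂ) : Prop :=
  ∀ (V : Set (CSpace N)) (L : CSpace N → ℂ ⊗[ℝ] CSpace N),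
    IsOpen V → IsLocalSectionT01 M V L → ∀ q ∈ M ∩ V, derivAlong M f q (L q) = 0

/-! Near p, parametrize M by a real-analytic ψ and complexify: ψ extends to a holomorphic Ψ on ℂ^d,
and f ∘ ψ to a holomorphic h. The image of dψ(0) is T_pM, so genericity makes Ψ a submersion. A
holomorphic field X tangent to the fibres of Ψ satisfies, at real points, dψ(Re X) + i dψ(Im X) = 0.
This says precisely that X pushes forward to a section of T^{0,1}M, so the CR equations give dh(X) =
0 at real points, and then near 0, because ℝ^d is a uniqueness set for holomorphic functions. Thus h
is constant along the fibres of Ψ and descends to a holomorphic F with F ∘ ψ = f ∘ ψ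
(`IsCRFunction.exists_local_extension`).

The local extensions agree on overlaps because a holomorphic germ vanishing on a generic set is zero
(`eventually_eq_zero_of_generic`). Conversely, df and dF agree on tangent vectors to M, and the
complex-linear dF kills antiholomorphic vectors. -/

/-! ### Analytic charts, complexification and Taylor coefficients -/

/-- Implicit function theorem with analytic inverse. Over ℝ it parametrizes M; over ℂ it straightens
the fibres of Ψ. -/
theorem AnalyticAt.exists_submersion_chart {𝕜 E F : Type*} [RCLike 𝕜]
    [NormedAddCommGroup E] [NormedSpace 𝕜 E] [FiniteDimensional 𝕜 E]
    [NormedAddCommGroup F] [NormedSpace 𝕜 F] [FiniteDimensional 𝕜 F] {f : E → F} {a : E}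
    (hf : AnalyticAt 𝕜 f a) (hs : (fderiv 𝕜 f a).range = ⊤) :
    ∃ (Φ : OpenPartialHomeomorph E (F × (fderiv 𝕜 f a).ker))
      (π : E →L[𝕜] (fderiv 𝕜 f a).ker), a ∈ Φ.source ∧ (∀ x, Φ x = (f x, π (x - a))) ∧
        AnalyticAt 𝕜 Φ.symm (f a, 0) := by
  have : CompleteSpace E := FiniteDimensional.complete 𝕜 E
  have : CompleteSpace F := FiniteDimensional.complete 𝕜 F
  have hker := (fderiv 𝕜 f a).ker_closedComplemented_of_finiteDimensional_range
  let φ := HasStrictFDerivAt.implicitFunctionDataOfComplemented f (fderiv 𝕜 f a)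
    hf.hasStrictFDerivAt hs hker
  refine ⟨φ.toOpenPartialHomeomorph, Classical.choose hker,
    φ.pt_mem_toOpenPartialHomeomorph_source, fun x => rfl, ?_⟩
  have hself : φ.toOpenPartialHomeomorph a = (f a, 0) := by
    change (f a, Classical.choose hker (a - a)) = _
    simp
  rw [← hself]
  refine φ.toOpenPartialHomeomorph.analyticAt_symm'
    (i := φ.leftDeriv.equivProdOfSurjectiveOfIsCompl φ.rightDeriv φ.range_leftDeriv
      φ.range_rightDeriv φ.isCompl_ker) φ.pt_mem_toOpenPartialHomeomorph_source ?_ ?_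
  · change AnalyticAt 𝕜 (fun x => (f x, Classical.choose hker (x - a))) a
    exact hf.prod (((Classical.choose hker).analyticAt _).comp
      (analyticAt_id.sub analyticAt_const))
  · exact φ.hasStrictFDerivAt.hasFDerivAt.fderiv

/-- A real-analytic function of real coordinates extends to a holomorphic function of the
corresponding complex coordinates. -/
theorem AnalyticAt.exists_complexification {d : ℕ} {V : Type*} [NormedAddCommGroup V]
    [NormedSpace ℂ V] [CompleteSpace V] {g : (Fin d → ℝ) → V} (hg : AnalyticAt ℝ g 0) :
    ∃ G : CSpace d → V, AnalyticAt ℂ G 0 ∧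
      ∀ᶠ t : Fin d → ℝ in 𝓝 0, G (fun i => (t i : ℂ)) = g t := by
  obtain ⟨p, R, hp⟩ := hg
  -- Expand `p k` in the standard basis and let the coordinates become complex.
  let q : FormalMultilinearSeries ℂ (CSpace d) V := fun k =>
    ∑ s : Fin k → Fin d,
      ((ContinuousMultilinearMap.mkPiAlgebra ℂ (Fin k) ℂ).compContinuousLinearMap
        (fun i => ContinuousLinearMap.proj (R := ℂ) (φ := fun _ : Fin d => ℂ) (s i))).smulRight
        (p k (fun i => Pi.single (s i) (1 : ℝ)))
  have hq : ∀ k (t : Fin d → ℝ), q k (fun _ i => (t i : ℂ)) = p k (fun _ => t) := by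
    intro k t
    have ht : t = ∑ i, t i • (Pi.single i (1 : ℝ) : Fin d → ℝ) := by
      simpa using pi_eq_sum_univ' t
    conv_rhs => rw [ht]
    have := (p k).toMultilinearMap.map_sum
      (fun (_ : Fin k) (i : Fin d) => t i • (Pi.single i (1 : ℝ) : Fin d → ℝ))
    simp only [ContinuousMultilinearMap.coe_coe] at this
    rw [this]
    simp only [q, sum_apply]
    refine Finset.sum_congr rfl fun s _ => ?_
    rw [ContinuousMultilinearMap.map_smul_univ]
    simp [← Complex.ofReal_prod, Complex.coe_smul]
  have hbound : ∀ k, ‖q k‖ ≤ (d : ℝ) ^ k * ‖p k‖ := by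
    intro k
    calc ‖q k‖ ≤ ∑ s : Fin k → Fin d, ‖p k‖ := by
          refine norm_sum_le_of_le _ fun s _ => ?_
          rw [ContinuousMultilinearMap.norm_smulRight]
          have h1 : ‖(ContinuousMultilinearMap.mkPiAlgebra ℂ (Fin k) ℂ).compContinuousLinearMap
              (fun i => ContinuousLinearMap.proj (R := ℂ) (φ := fun _ : Fin d => ℂ) (s i))‖ ≤ 1 := by
            refine ContinuousMultilinearMap.opNorm_le_bound zero_le_one fun m => ?_
            simp only [ContinuousMultilinearMap.compContinuousLinearMap_apply,
              ContinuousMultilinearMap.mkPiAlgebra_apply, norm_prod, one_mul]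
            exact Finset.prod_le_prod (fun _ _ => norm_nonneg _) fun i _ => norm_le_pi_norm (m i) (s i)
          have h2 : ‖p k (fun i => Pi.single (s i) (1 : ℝ))‖ ≤ ‖p k‖ := by
            refine ((p k).le_opNorm _).trans (mul_le_of_le_one_right (norm_nonneg _) ?_)
            refine Finset.prod_le_one (fun _ _ => norm_nonneg _) fun i _ => ?_
            simp [Pi.norm_single]
          nlinarith [norm_nonneg (p k (fun i => Pi.single (s i) (1 : ℝ)))]
      _ = (d : ℝ) ^ k * ‖p k‖ := by simp
  have hrad : 0 < q.radius := by
    obtain ⟨r, hr0, hr⟩ := ENNReal.lt_iff_exists_nnreal_btwn.1 (hp.r_pos.trans_le hp.r_le)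
    obtain ⟨C, -, hC⟩ := p.norm_mul_pow_le_of_lt_radius hr
    have hr0' : 0 < r := by exact_mod_cast hr0
    have hd : (0 : NNReal) < d + 1 := by positivity
    -- The d^k terms of `q k` cost a factor d in the radius; d + 1 avoids dividing by zero when d =
    -- 0.
    refine lt_of_lt_of_le (b := ((r / (d + 1) : NNReal) : ENNReal)) ?_
      (q.le_radius_of_bound C fun k => ?_)
    · exact_mod_cast div_pos hr0' hd
    · refine le_trans ?_ (hC k)
      have h3 : (d : ℝ) * (r / (d + 1)) ≤ r := by
        rw [← mul_div_assoc, div_le_iff₀ (by positivity)]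
        nlinarith [r.coe_nonneg]
      calc ‖q k‖ * ((r / (d + 1) : NNReal) : ℝ) ^ k
          ≤ ((d : ℝ) ^ k * ‖p k‖) * ((r : ℝ) / (d + 1)) ^ k := by
            push_cast
            gcongr
            exact hbound k
        _ = ‖p k‖ * ((d : ℝ) * (r / (d + 1))) ^ k := by rw [mul_pow]; ring
        _ ≤ ‖p k‖ * (r : ℝ) ^ k := by gcongr
  have hQ := q.hasFPowerSeriesOnBall hrad
  refine ⟨q.sum, hQ.analyticAt, ?_⟩
  filter_upwards [Metric.eball_mem_nhds (0 : Fin d → ℝ) hp.r_pos] with t ht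
  have h1 := (hp.hasSum ht).tsum_eq
  rw [zero_add] at h1
  rw [← h1, FormalMultilinearSeries.sum]
  exact tsum_congr fun k => hq k t

/-- An analytic function all of whose derivatives vanish at a point vanishes near that point. -/
theorem AnalyticAt.eventually_eq_zero_of_iteratedFDeriv {𝕜 E F : Type*} [RCLike 𝕜]
    [NormedAddCommGroup E] [NormedSpace 𝕜 E] [NormedAddCommGroup F] [NormedSpace 𝕜 F]
    [CompleteSpace F] {f : E → F} {a : E}
    (hf : AnalyticAt 𝕜 f a) (h : ∀ k, iteratedFDeriv 𝕜 k f a = 0) : ∀ᶠ x in 𝓝 a, f x = 0 := by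
  obtain ⟨p, R, hp⟩ := hf
  filter_upwards [Metric.eball_mem_nhds a hp.r_pos] with x hx
  have hx' : x - a ∈ Metric.eball (0 : E) R := by
    simpa [edist_eq_enorm_sub] using hx
  have h1 := hp.hasSum_iteratedFDeriv hx'
  simp only [h, add_sub_cancel] at h1
  simpa using h1.unique (by simp)

/-! ### Tangent vectors and uniqueness on generic sets -/

/-- Chain rule along curves drawn on A. It holds for any derivative within A, which matters because
derivatives within M need not be unique off tangent directions. -/
theorem fderiv_apply_eq_zero_of_realTangent {N : ℕ} {W : Type*} [NormedAddCommGroup W]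
    [NormedSpace ℝ W] {A : Set (CSpace N)} {q : CSpace N} {G : CSpace N → W}
    {G' : CSpace N →L[ℝ] W} (hG : HasFDerivWithinAt G G' A q)
    (h : ∀ᶠ x in 𝓝 q, x ∈ A → G x = 0) {v : CSpace N} (hv : v ∈ realTangent A q) : G' v = 0 := by
  have : realTangent A q ≤ LinearMap.ker (G' : CSpace N →ₗ[ℝ] W) := by
    refine Submodule.span_le.2 ?_
    rintro v ⟨γ, h0, hγ, hd⟩
    have hq : q ∈ A := h0 ▸ hγ.self_of_nhds
    have h1 : HasDerivAt (G ∘ γ) (G' v) 0 := by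
      rw [← h0] at hG
      have := HasFDerivWithinAt.comp_hasDerivWithinAt (s := γ ⁻¹' A) (0 : ℝ) hG
        hd.hasDerivWithinAt fun _ hx => hx
      exact this.hasDerivAt hγ
    have h2 : HasDerivAt (G ∘ γ) 0 0 := by
      refine (hasDerivAt_const (0 : ℝ) (0 : W)).congr_of_eventuallyEq ?_
      filter_upwards [hγ, hd.continuousAt.eventually (h0 ▸ h)] with t ht ht'
      exact ht' ht
    simpa using h1.unique h2
  exact this hv

/-- The kernel of a complex-linear map is stable under J. -/
theorem clm_eq_zero_of_generic {N : ℕ} {W : Type*} [NormedAddCommGroup W] [NormedSpace ℂ W]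
    {T : Submodule ℝ (CSpace N)} (hT : T ⊔ T.map (complexStructure N) = ⊤)
    {l : CSpace N →L[ℂ] W} (h : ∀ v ∈ T, l v = 0) : l = 0 := by
  have : (⊤ : Submodule ℝ (CSpace N)) ≤ LinearMap.ker ((l : CSpace N →ₗ[ℂ] W).restrictScalars ℝ) := by
    rw [← hT, sup_le_iff]
    refine ⟨fun v hv => h v hv, ?_⟩
    rintro _ ⟨v, hv, rfl⟩
    have hv' : l v = 0 := h v hv
    simp [complexStructure, hv']
  ext1 v
  exact this (x := v) trivial

/-- A holomorphic function which vanishes on a generic set near a point of it vanishes near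
that point. -/
theorem eventually_eq_zero_of_generic {N : ℕ} {W : Type*} [NormedAddCommGroup W] [NormedSpace ℂ W]
    [CompleteSpace W] {A : Set (CSpace N)} {q : CSpace N} (hq : q ∈ A)
    (hA : ∀ᶠ x in 𝓝 q, x ∈ A → realTangent A x ⊔ (realTangent A x).map (complexStructure N) = ⊤)
    {G : CSpace N → W} (hG : AnalyticAt ℂ G q) (h : ∀ᶠ x in 𝓝 q, x ∈ A → G x = 0) :
    ∀ᶠ x in 𝓝 q, G x = 0 := by
  -- If the k-th derivative vanishes on A, its own derivative is complex linear and kills tangent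
  -- vectors, hence is zero by genericity. So the whole Taylor series at q vanishes.
  have key : ∀ k, ∀ᶠ x in 𝓝 q, x ∈ A → iteratedFDeriv ℂ k G x = 0 := by
    intro k
    induction k with
    | zero =>
      filter_upwards [h] with x hx hxA
      ext m
      simp [hx hxA]
    | succ k ih =>
      filter_upwards [hA, ih.eventually_nhds, hG.eventually_analyticAt] with x hx hxk hxG hxA
      have hd : fderiv ℂ (iteratedFDeriv ℂ k G) x = 0 := by
        refine clm_eq_zero_of_generic (hx hxA) fun v hv => ?_
        have h0 : AnalyticOnNhd ℂ G {y | AnalyticAt ℂ G y} := fun y hy => hy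
        have h1 := (h0.iteratedFDeriv k x hxG).differentiableAt.hasFDerivAt.restrictScalars ℝ
        exact fderiv_apply_eq_zero_of_realTangent h1.hasFDerivWithinAt hxk hv
      rw [iteratedFDeriv_succ_eq_comp_left, Function.comp_apply, hd, LinearIsometryEquiv.map_zero]
  exact hG.eventually_eq_zero_of_iteratedFDeriv fun k => (key k).self_of_nhds hq

/-! ### Parametrizations of M -/

/-- A functional killing the range is a linear relation among the `l i`. -/
theorem range_pi_eq_top_of_linearIndependent {c : ℕ} {E : Type*} [AddCommGroup E] [Module ℝ E]
    {l : Fin c → E →ₗ[ℝ] ℝ} (hl : LinearIndependent ℝ l) : (LinearMap.pi l).range = ⊤ := by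
  by_contra h
  obtain ⟨φ, hφ, hle⟩ := Submodule.exists_le_ker_of_lt_top _ (lt_top_iff_ne_top.2 h)
  refine hφ ?_
  have h1 : ∀ i, φ (Pi.single i 1) = 0 := by
    refine Fintype.linearIndependent_iff.1 hl (fun i => φ (Pi.single i 1)) ?_
    ext v
    have h2 : φ (LinearMap.pi l v) = 0 := hle ⟨v, rfl⟩
    rw [pi_eq_sum_univ' (LinearMap.pi l v)] at h2
    simpa [mul_comm] using h2
  refine LinearMap.pi_ext' fun i => ?_
  ext
  simpa using h1 i

/-- A real-analytic submanifold has real-analytic parametrizations `ψ`, with a real-analytic left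
inverse `ρ` defined on a neighborhood in the ambient space. -/
theorem IsAnalyticSubmanifold.exists_parametrization {N c : ℕ} {M : Set (CSpace N)}
    (hM : IsAnalyticSubmanifold c M) {p : CSpace N} (hp : p ∈ M) :
    ∃ (d : ℕ) (ψ : (Fin d → ℝ) → CSpace N) (ρ : CSpace N → (Fin d → ℝ)),
      AnalyticAt ℝ ψ 0 ∧ AnalyticAt ℝ ρ p ∧ ψ 0 = p ∧ ρ p = 0 ∧
        (∀ᶠ t in 𝓝 0, ψ t ∈ M ∧ ρ (ψ t) = t) ∧ ∀ᶠ x in 𝓝 p, x ∈ M → ψ (ρ x) = x := by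
  obtain ⟨U, hU, hpU, r, hr, hMU, hli⟩ := hM p hp
  have hpr : ∀ j, r j p = 0 := by
    have : p ∈ M ∩ U := ⟨hp, hpU⟩
    rw [hMU] at this
    exact this.2
  let f : CSpace N → (Fin c → ℝ) := fun x j => r j x
  have hfp : f p = 0 := funext hpr
  have hf : AnalyticAt ℝ f p := AnalyticAt.pi fun j => hr j p hpU
  have hs : (fderiv ℝ f p).range = ⊤ := by
    have h1 : fderiv ℝ f p = ContinuousLinearMap.pi fun j => fderiv ℝ (r j) p :=
      fderiv_pi fun j => (hr j p hpU).differentiableAt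
    have h2 : LinearIndependent ℝ fun j => (fderiv ℝ (r j) p : CSpace N →ₗ[ℝ] ℝ) :=
      (hli p hpU).map' (ContinuousLinearMap.coeLM ℝ)
        (LinearMap.ker_eq_bot.2 ContinuousLinearMap.coe_injective)
    rw [h1]
    exact range_pi_eq_top_of_linearIndependent h2
  obtain ⟨Φ, π, hpΦ, hΦ, hsymm⟩ := hf.exists_submersion_chart hs
  let K := (fderiv ℝ f p).ker
  let e : K ≃L[ℝ] (Fin (Module.finrank ℝ K) → ℝ) := ContinuousLinearEquiv.ofFinrankEq (by simp)
  have hΦp : Φ p = (0, 0) := by rw [hΦ, hfp]; simp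
  rw [hfp] at hsymm
  have h0 : (fun t => ((0, e.symm t) : (Fin c → ℝ) × K)) 0 = (0, 0) := by simp
  have hψ0 : Φ.symm (0, e.symm 0) = p := by
    rw [map_zero, ← hΦp, Φ.left_inv hpΦ]
  have hψ : AnalyticAt ℝ (fun t => Φ.symm (0, e.symm t)) 0 := by
    refine AnalyticAt.fun_comp (g := Φ.symm) (f := fun t => ((0, e.symm t) : (Fin c → ℝ) × K)) ?_ ?_
    · rw [map_zero]; exact hsymm
    · exact analyticAt_const.prod (e.symm.toContinuousLinearMap.analyticAt _)
  -- In the chart M is the slice f = 0: ψ is the inverse chart on this slice, and ρ reads off the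
  -- kernel coordinate.
  refine ⟨_, fun t => Φ.symm (0, e.symm t), fun x => e (π (x - p)), hψ, ?_, hψ0, by simp, ?_, ?_⟩
  · exact (e.toContinuousLinearMap.analyticAt _).comp
      ((π.analyticAt _).comp (analyticAt_id.sub analyticAt_const))
  · have h1 : ∀ᶠ t in 𝓝 0, ((0, e.symm t) : (Fin c → ℝ) × K) ∈ Φ.target := by
      have hc : ContinuousAt (fun t => ((0, e.symm t) : (Fin c → ℝ) × K)) 0 := by fun_prop
      refine hc.eventually (Φ.open_target.mem_nhds ?_)
      rw [h0, ← hΦp]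
      exact Φ.map_source hpΦ
    have h2 : ∀ᶠ t in 𝓝 0, Φ.symm (0, e.symm t) ∈ U :=
      hψ.continuousAt.eventually (hU.mem_nhds (by simpa only [hψ0] using hpU))
    filter_upwards [h1, h2] with t ht1 ht2
    have h3 := Φ.right_inv ht1
    rw [hΦ] at h3
    obtain ⟨h4, h5⟩ := Prod.ext_iff.1 h3
    refine ⟨?_, ?_⟩
    · have : Φ.symm (0, e.symm t) ∈ M ∩ U := by
        rw [hMU]
        exact ⟨ht2, fun j => congrFun h4 j⟩
      exact this.1
    · have h6 : π (Φ.symm (0, e.symm t) - p) = e.symm t := h5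
      rw [h6, e.apply_symm_apply]
  · filter_upwards [Φ.open_source.mem_nhds hpΦ, hU.mem_nhds hpU] with x hx1 hx2 hxM
    have h3 : f x = 0 := by
      have : x ∈ M ∩ U := ⟨hxM, hx2⟩
      rw [hMU] at this
      exact funext this.2
    rw [e.symm_apply_apply, ← h3, ← hΦ, Φ.left_inv hx1]

theorem fderiv_mem_realTangent {N d : ℕ} {M : Set (CSpace N)} {ψ : (Fin d → ℝ) → CSpace N}
    {t : Fin d → ℝ} (hψ : DifferentiableAt ℝ ψ t) (hM : ∀ᶠ s in 𝓝 t, ψ s ∈ M) (v : Fin d → ℝ) :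
    fderiv ℝ ψ t v ∈ realTangent M (ψ t) := by
  have h1 : HasDerivAt (fun s : ℝ => t + s • v) v 0 := by
    simpa using ((hasDerivAt_id (0 : ℝ)).smul_const v).const_add t
  have h0 : (fun s : ℝ => t + s • v) 0 = t := by simp
  refine Submodule.subset_span ⟨fun s => ψ (t + s • v), by simp, ?_, ?_⟩
  · exact h1.continuousAt.eventually (by rw [h0]; exact hM)
  · refine HasFDerivAt.comp_hasDerivAt (0 : ℝ) (l := ψ) (f := fun s : ℝ => t + s • v) ?_ h1
    simpa using hψ.hasFDerivAt

/-- The map ψ ∘ ρ - id vanishes on M near p. Consequently the image of dψ contains the tangent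
space. -/
theorem fderiv_fderiv_eq_self_of_mem_realTangent {N d : ℕ} {M : Set (CSpace N)} {ψ : (Fin d → ℝ) → CSpace N}
    {ρ : CSpace N → (Fin d → ℝ)} {p : CSpace N} (hψ : DifferentiableAt ℝ ψ (ρ p))
    (hρ : DifferentiableAt ℝ ρ p) (h : ∀ᶠ x in 𝓝 p, x ∈ M → ψ (ρ x) = x) {v : CSpace N}
    (hv : v ∈ realTangent M p) : fderiv ℝ ψ (ρ p) (fderiv ℝ ρ p v) = v := by
  have h1 : HasFDerivAt (fun x => ψ (ρ x) - x)
      ((fderiv ℝ ψ (ρ p)).comp (fderiv ℝ ρ p) - ContinuousLinearMap.id ℝ _) p :=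
    (hψ.hasFDerivAt.comp p hρ.hasFDerivAt).sub (hasFDerivAt_id p)
  have h2 := fderiv_apply_eq_zero_of_realTangent (A := M) h1.hasFDerivWithinAt
    (h.mono fun x hx hxM => sub_eq_zero.2 (hx hxM)) hv
  exact sub_eq_zero.1 h2

/-! ### Holomorphic functions near ℝ^d in ℂ^d -/

/-- The inclusion `ℝ^d → ℂ^d`. -/
noncomputable def realPoint (d : ℕ) : (Fin d → ℝ) →L[ℝ] CSpace d :=
  ContinuousLinearMap.pi fun i => Complex.ofRealCLM.comp (ContinuousLinearMap.proj i)

/-- The coordinatewise real part `ℂ^d → ℝ^d`. -/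
noncomputable def coordRe (d : ℕ) : CSpace d →L[ℝ] (Fin d → ℝ) :=
  ContinuousLinearMap.pi fun i => Complex.reCLM.comp (ContinuousLinearMap.proj i)

/-- The coordinatewise imaginary part `ℂ^d → ℝ^d`. -/
noncomputable def coordIm (d : ℕ) : CSpace d →L[ℝ] (Fin d → ℝ) :=
  ContinuousLinearMap.pi fun i => Complex.imCLM.comp (ContinuousLinearMap.proj i)

theorem coordRe_realPoint {d : ℕ} (t : Fin d → ℝ) : coordRe d (realPoint d t) = t := rfl

theorem realPoint_add_I_smul {d : ℕ} (ξ : CSpace d) :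
    realPoint d (coordRe d ξ) + Complex.I • realPoint d (coordIm d ξ) = ξ := by
  ext i
  simp [realPoint, coordRe, coordIm, mul_comm Complex.I, Complex.re_add_im]

/-- At real points dG is the complex-linear extension of dg. -/
theorem eventually_fderiv_complexification {d : ℕ} {V : Type*} [NormedAddCommGroup V]
    [NormedSpace ℂ V] [CompleteSpace V] {g : (Fin d → ℝ) → V} {G : CSpace d → V}
    (hG : AnalyticAt ℂ G 0) (h : ∀ᶠ t in 𝓝 0, G (realPoint d t) = g t) :
    ∀ᶠ t in 𝓝 0, ∀ ξ, fderiv ℂ G (realPoint d t) ξ =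
      fderiv ℝ g t (coordRe d ξ) + Complex.I • fderiv ℝ g t (coordIm d ξ) := by
  have h1 : ∀ᶠ t in 𝓝 0, AnalyticAt ℂ G (realPoint d t) :=
    (realPoint d).continuous.continuousAt.eventually
      (by rw [map_zero]; exact hG.eventually_analyticAt)
  filter_upwards [h.eventually_nhds, h1] with t ht htG ξ
  have h2 : HasFDerivAt (fun t => G (realPoint d t))
      (((fderiv ℂ G (realPoint d t)).restrictScalars ℝ).comp (realPoint d)) t :=
    (htG.differentiableAt.hasFDerivAt.restrictScalars ℝ).comp t (realPoint d).hasFDerivAt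
  have h3 := (h2.congr_of_eventuallyEq (ht.mono fun _ hs => hs.symm)).fderiv
  conv_lhs => rw [← realPoint_add_I_smul ξ]
  rw [h3, map_add, map_smul]
  rfl

theorem realTangent_range_realPoint_generic {d : ℕ} {x : CSpace d}
    (hx : x ∈ Set.range (realPoint d)) :
    realTangent (Set.range (realPoint d)) x ⊔
      (realTangent (Set.range (realPoint d)) x).map (complexStructure d) = ⊤ := by
  obtain ⟨t, rfl⟩ := hx
  have h : ∀ v, realPoint d v ∈ realTangent (Set.range (realPoint d)) (realPoint d t) := by
    intro v
    have h1 := fderiv_mem_realTangent (M := Set.range (realPoint d)) (t := t)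
      (realPoint d).differentiableAt (.of_forall fun s => ⟨s, rfl⟩) v
    rwa [ContinuousLinearMap.fderiv] at h1
  refine eq_top_iff.2 fun ξ _ => ?_
  rw [← realPoint_add_I_smul ξ]
  exact Submodule.add_mem_sup (h _) ⟨_, h (coordIm d ξ), rfl⟩

/-- ℝ^d is itself generic in ℂ^d, so the uniqueness principle applies to it. -/
theorem eventually_eq_zero_of_realPoint {d : ℕ} {W : Type*} [NormedAddCommGroup W]
    [NormedSpace ℂ W] [CompleteSpace W] {G : CSpace d → W} (hG : AnalyticAt ℂ G 0)
    (h : ∀ᶠ t in 𝓝 0, G (realPoint d t) = 0) : ∀ᶠ s in 𝓝 0, G s = 0 := by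
  refine eventually_eq_zero_of_generic (A := Set.range (realPoint d)) ⟨0, map_zero _⟩
    (.of_forall fun x hx => realTangent_range_realPoint_generic hx) hG ?_
  have h1 : ∀ᶠ s in 𝓝 0, G (realPoint d (coordRe d s)) = 0 :=
    (coordRe d).continuous.continuousAt.eventually (by rw [map_zero]; exact h)
  filter_upwards [h1] with s hs
  rintro ⟨t, rfl⟩
  rwa [coordRe_realPoint] at hs

/-! ### From CR functions to local holomorphic extensions -/

theorem eventually_eq_of_fderiv_comp_inr_eq_zero {E W V : Type*} [NormedAddCommGroup E]
    [NormedSpace ℂ E] [NormedAddCommGroup W] [NormedSpace ℂ W] [NormedAddCommGroup V]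
    [NormedSpace ℂ V] {K : E × W → V} {p : E}
    (h : ∀ᶠ y in 𝓝 (p, (0 : W)), DifferentiableAt ℂ K y ∧ ∀ w, fderiv ℂ K y (0, w) = 0) :
    ∀ᶠ y in 𝓝 (p, (0 : W)), K y = K (y.1, 0) := by
  obtain ⟨ε, hε, hK⟩ := Metric.eventually_nhds_iff_ball.1 h
  refine Metric.eventually_nhds_iff_ball.2 ⟨ε, hε, ?_⟩
  rintro ⟨z, w⟩ hy
  rw [← ball_prod_same] at hy
  have hd : ∀ w' ∈ Metric.ball (0 : W) ε,
      HasFDerivAt (fun w' => K (z, w')) (0 : W →L[ℂ] V) w' := by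
    intro w' hw'
    obtain ⟨h1, h2⟩ := hK (z, w') (by rw [← ball_prod_same]; exact ⟨hy.1, hw'⟩)
    have h3 : HasFDerivAt (fun w' => K (z, w')) _ w' :=
      h1.hasFDerivAt.comp w' (hasFDerivAt_prodMk_right z w')
    convert h3 using 1
    ext v
    exact (h2 v).symm
  exact Metric.isOpen_ball.is_const_of_fderiv_eq_zero
    (convex_ball (0 : W) ε).isPreconnected
    (fun w' hw' => (hd w' hw').differentiableAt.differentiableWithinAt)
    (fun w' hw' => (hd w' hw').fderiv) hy.2 (Metric.mem_ball_self hε)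

theorem derivAlong_tmul_add {N : ℕ} (M : Set (CSpace N)) (f : CSpace N → ℂ) (q P Q : CSpace N) :
    derivAlong M f q ((1 : ℂ) ⊗ₜ[ℝ] P + Complex.I ⊗ₜ[ℝ] Q) =
      fderivWithin ℝ f M q P + Complex.I • fderivWithin ℝ f M q Q := by
  simp [derivAlong]

theorem fderivWithin_fderiv_of_eventually_mem {N d : ℕ} {M : Set (CSpace N)} {f : CSpace N → ℂ}
    {ψ : (Fin d → ℝ) → CSpace N} {g : (Fin d → ℝ) → ℂ} {t : Fin d → ℝ}
    (hf : DifferentiableWithinAt ℝ f M (ψ t)) (hψ : DifferentiableAt ℝ ψ t)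
    (hM : ∀ᶠ s in 𝓝 t, ψ s ∈ M) (hg : ∀ᶠ s in 𝓝 t, f (ψ s) = g s) (u : Fin d → ℝ) :
    fderivWithin ℝ f M (ψ t) (fderiv ℝ ψ t u) = fderiv ℝ g t u := by
  have h1 : HasFDerivWithinAt (f ∘ ψ) ((fderivWithin ℝ f M (ψ t)).comp (fderiv ℝ ψ t))
      (ψ ⁻¹' M) t :=
    hf.hasFDerivWithinAt.comp t hψ.hasFDerivAt.hasFDerivWithinAt fun _ hx => hx
  have h2 := (h1.hasFDerivAt hM).congr_of_eventuallyEq (hg.mono fun _ hs => hs.symm)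
  rw [h2.fderiv]
  rfl

theorem AnalyticAt.clm_apply {𝕜 E F G : Type*} [NontriviallyNormedField 𝕜]
    [NormedAddCommGroup E] [NormedSpace 𝕜 E] [NormedAddCommGroup F] [NormedSpace 𝕜 F]
    [NormedAddCommGroup G] [NormedSpace 𝕜 G] {f : E → F →L[𝕜] G} {g : E → F} {x : E}
    (hf : AnalyticAt 𝕜 f x) (hg : AnalyticAt 𝕜 g x) : AnalyticAt 𝕜 (fun y => f y (g y)) x :=
  AnalyticAt.fun_comp (g := fun z : (F →L[𝕜] G) × F => z.1 z.2) (f := fun y => (f y, g y))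
    ((ContinuousLinearMap.id 𝕜 (F →L[𝕜] G)).analyticAt_bilinear (f x, g x)) (hf.prod hg)

theorem AnalyticAt.clm_comp {𝕜 E F G H : Type*} [NontriviallyNormedField 𝕜]
    [NormedAddCommGroup E] [NormedSpace 𝕜 E] [NormedAddCommGroup F] [NormedSpace 𝕜 F]
    [NormedAddCommGroup G] [NormedSpace 𝕜 G] [NormedAddCommGroup H] [NormedSpace 𝕜 H]
    {f : E → G →L[𝕜] H} {g : E → F →L[𝕜] G} {x : E}
    (hf : AnalyticAt 𝕜 f x) (hg : AnalyticAt 𝕜 g x) :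
    AnalyticAt 𝕜 (fun y => (f y).comp (g y)) x :=
  AnalyticAt.fun_comp (g := fun z : (G →L[𝕜] H) × (F →L[𝕜] G) => z.1.comp z.2)
    (f := fun y => (f y, g y))
    ((ContinuousLinearMap.compL 𝕜 F G H).analyticAt_bilinear (f x, g x)) (hf.prod hg)

/-- In a parametrization `ψ` of `M`, a CR function is annihilated by the complex vector fields
which are annihilated by the differential of `ψ`. -/
theorem IsCRFunction.eventually_fderiv_eq_zero {N d : ℕ} {W : Type*} {M : Set (CSpace N)}
    {f : CSpace N → ℂ} (hCR : IsCRFunction M f) (hf : DifferentiableOn ℝ f M) {p : CSpace N}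
    {ψ : (Fin d → ℝ) → CSpace N} {ρ : CSpace N → (Fin d → ℝ)} {g : (Fin d → ℝ) → ℂ}
    (hψ : AnalyticAt ℝ ψ 0) (hρ : AnalyticAt ℝ ρ p) (hψ0 : ψ 0 = p) (hρp : ρ p = 0)
    (hpar : ∀ᶠ t in 𝓝 0, ψ t ∈ M ∧ ρ (ψ t) = t) (hMρ : ∀ᶠ x in 𝓝 p, x ∈ M → ψ (ρ x) = x)
    (hg : ∀ᶠ t in 𝓝 0, f (ψ t) = g t) {X : (Fin d → ℝ) → W → CSpace d}
    (hX : ∀ᶠ t in 𝓝 0, ∀ w, AnalyticAt ℝ (fun t => X t w) t)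
    (hX0 : ∀ᶠ t in 𝓝 0, ∀ w, fderiv ℝ ψ t (coordRe d (X t w)) +
      Complex.I • fderiv ℝ ψ t (coordIm d (X t w)) = 0) :
    ∀ᶠ t in 𝓝 0, ∀ w, fderiv ℝ g t (coordRe d (X t w)) +
      Complex.I • fderiv ℝ g t (coordIm d (X t w)) = 0 := by
  have hgood := hψ.eventually_analyticAt.and (((hpar.mono fun _ h => h.1).eventually_nhds).and
    (hg.eventually_nhds.and (hX.and hX0)))
  have hgood' := hρ.continuousAt.eventually (by rw [hρp]; exact hgood)
  -- Sections live on open parts of M, so the conditions on the parameter are pulled back by ρ to an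
  -- ambient neighborhood.
  obtain ⟨V, hV, hVo, hpV⟩ := eventually_nhds_iff.1
    (hgood'.and (hρ.eventually_analyticAt.and hMρ))
  have hψV : ∀ᶠ t in 𝓝 0, ψ t ∈ V :=
    hψ.continuousAt.eventually (hVo.mem_nhds (by rw [hψ0]; exact hpV))
  filter_upwards [hpar, hψV] with t ht htV w
  have hη : ∀ q ∈ V, AnalyticAt ℝ (fun q => X (ρ q) w) q := fun q hq =>
    ((hV q hq).1.2.2.2.1 w).fun_comp (hV q hq).2.1
  have hdψ : ∀ q ∈ V, AnalyticAt ℝ (fun q => fderiv ℝ ψ (ρ q)) q := fun q hq =>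
    (hV q hq).1.1.fderiv.fun_comp (hV q hq).2.1
  have hL : IsLocalSectionT01 M V fun q =>
      (1 : ℂ) ⊗ₜ[ℝ] fderiv ℝ ψ (ρ q) (coordRe d (X (ρ q) w)) +
        Complex.I ⊗ₜ[ℝ] fderiv ℝ ψ (ρ q) (coordIm d (X (ρ q) w)) := by
    refine ⟨⟨_, _, fun q hq => AnalyticAt.analyticWithinAt ?_,
      fun q hq => AnalyticAt.analyticWithinAt ?_, fun q hq => rfl⟩, fun q hq => ⟨?_, ?_⟩⟩
    · exact (hdψ q hq.2).clm_apply (((coordRe d).analyticAt _).fun_comp (hη q hq.2))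
    · exact (hdψ q hq.2).clm_apply (((coordIm d).analyticAt _).fun_comp (hη q hq.2))
    · have h0 := (hV q hq.2).1.2.2.2.2 w
      refine ⟨fderiv ℝ ψ (ρ q) (coordRe d (X (ρ q) w)), ?_⟩
      -- From dψ(Re X) = -i dψ(Im X), multiplication by i gives J dψ(Re X) = dψ(Im X).
      have hJ : complexStructure N (fderiv ℝ ψ (ρ q) (coordRe d (X (ρ q) w))) =
          fderiv ℝ ψ (ρ q) (coordIm d (X (ρ q) w)) := by
        rw [eq_neg_of_add_eq_zero_left h0]
        simp [complexStructure, smul_smul]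
      rw [antiholVector, hJ]
    · have hq' := (hV q hq.2).2.2 hq.1
      have hmem : ∀ u, fderiv ℝ ψ (ρ q) u ∈ realTangent M q := fun u => by
        have := fderiv_mem_realTangent (hV q hq.2).1.1.differentiableAt (hV q hq.2).1.2.1 u
        rwa [hq'] at this
      exact add_mem (Submodule.tmul_mem_baseChange_of_mem _ (hmem _))
        (Submodule.tmul_mem_baseChange_of_mem _ (hmem _))
  have h1 := hCR V _ hVo hL (ψ t) ⟨ht.1, htV⟩
  obtain ⟨hψt, hMt, hgt, -, -⟩ := (hV _ htV).1
  rw [ht.2] at hψt hMt hgt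
  rw [derivAlong_tmul_add, ht.2,
    fderivWithin_fderiv_of_eventually_mem (hf _ ht.1) hψt.differentiableAt hMt hgt,
    fderivWithin_fderiv_of_eventually_mem (hf _ ht.1) hψt.differentiableAt hMt hgt] at h1
  exact h1

/-- The range of L is a complex subspace containing the image of D, hence T_pM + J T_pM. -/
theorem range_fderiv_complexification_eq_top {N d : ℕ} {M : Set (CSpace N)} {p : CSpace N}
    (hgen : realTangent M p ⊔ (realTangent M p).map (complexStructure N) = ⊤)
    {D : (Fin d → ℝ) →L[ℝ] CSpace N} (hD : ∀ v ∈ realTangent M p, ∃ u, D u = v)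
    {L : CSpace d →L[ℂ] CSpace N}
    (hL : ∀ ξ, L ξ = D (coordRe d ξ) + Complex.I • D (coordIm d ξ)) : L.range = ⊤ := by
  refine eq_top_iff.2 fun x _ => ?_
  have hx : x ∈ realTangent M p ⊔ (realTangent M p).map (complexStructure N) := hgen ▸ trivial
  have hLD : ∀ u, L (realPoint d u) = D u := fun u => by
    have h0 : coordIm d (realPoint d u) = 0 := rfl
    rw [hL, coordRe_realPoint, h0, map_zero, smul_zero, add_zero]
  obtain ⟨a, ha, _, ⟨b, hb, rfl⟩, rfl⟩ := Submodule.mem_sup.1 hx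
  obtain ⟨u, rfl⟩ := hD a ha
  obtain ⟨v, rfl⟩ := hD b hb
  refine ⟨realPoint d u + Complex.I • realPoint d v, ?_⟩
  change L _ = _
  rw [map_add, map_smul, hLD, hLD]
  rfl

/-- A real-analytic CR function on a generic submanifold extends holomorphically near each
point. -/
theorem IsCRFunction.exists_local_extension {N c : ℕ} {M : Set (CSpace N)} {f : CSpace N → ℂ}
    (hM : IsAnalyticSubmanifold c M) (hgen : IsCRGeneric M) (hf : AnalyticOn ℝ f M)
    (hCR : IsCRFunction M f) {p : CSpace N} (hp : p ∈ M) :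
    ∃ F : CSpace N → ℂ, AnalyticAt ℂ F p ∧ ∀ᶠ x in 𝓝 p, x ∈ M → F x = f x := by
  obtain ⟨d, ψ, ρ, hψ, hρ, hψ0, hρp, hpar, hMρ⟩ := hM.exists_parametrization hp
  -- Only the values of f on M are analytic; g₀ is an ambient analytic function with the same values
  -- on M near p.
  obtain ⟨g₀, -, hfg₀, hg₀⟩ := analyticWithinAt_iff_exists_analyticAt'.1 (hf p hp)
  have hg : AnalyticAt ℝ (fun t => g₀ (ψ t)) 0 := AnalyticAt.fun_comp (hψ0 ▸ hg₀) hψ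
  have hfg : ∀ᶠ t in 𝓝 0, f (ψ t) = g₀ (ψ t) :=
    hpar.mono fun t ht => hfg₀ (Set.mem_insert_of_mem _ ht.1)
  obtain ⟨Ψ, hΨ, hΨψ⟩ := hψ.exists_complexification
  obtain ⟨h, hh, hhg⟩ := hg.exists_complexification
  have hdΨ := eventually_fderiv_complexification hΨ hΨψ
  have hdh := eventually_fderiv_complexification hh hhg
  have hΨ0 : Ψ 0 = p := by
    rw [← hψ0, ← hΨψ.self_of_nhds]
    exact congrArg Ψ (map_zero (realPoint d)).symm
  have hsurj : (fderiv ℂ Ψ 0).range = ⊤ := by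
    refine range_fderiv_complexification_eq_top (hgen p hp) (D := fderiv ℝ ψ 0) ?_ ?_
    · intro v hv
      have := fderiv_fderiv_eq_self_of_mem_realTangent (by rw [hρp]; exact hψ.differentiableAt)
        hρ.differentiableAt hMρ hv
      rw [hρp] at this
      exact ⟨_, this⟩
    · simpa using hdΨ.self_of_nhds
  obtain ⟨Φ, π, h0Φ, hΦ, hS⟩ := hΨ.exists_submersion_chart hsurj
  have hΦ0 : Φ 0 = (p, 0) := by rw [hΦ, hΨ0]; simp
  have hS0 : Φ.symm (p, 0) = 0 := by rw [← hΦ0, Φ.left_inv h0Φ]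
  rw [hΨ0] at hS
  have hΦan : AnalyticAt ℂ Φ 0 := by
    have : (Φ : CSpace d → _) = fun x => (Ψ x, π (x - 0)) := funext hΦ
    rw [this]
    exact hΨ.prod ((π.analyticAt _).fun_comp (analyticAt_id.sub analyticAt_const))
  let K := (fderiv ℂ Ψ 0).ker
  -- The vertical coordinate fields of the chart Φ, which are tangent to the fibres of Ψ because Ψ ∘
  -- Φ⁻¹ is the first projection.
  let X : CSpace d → K →L[ℂ] CSpace d := fun s =>
    (fderiv ℂ Φ.symm (Φ s)).comp (ContinuousLinearMap.inr ℂ (CSpace N) K)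
  have hX : AnalyticAt ℂ X 0 :=
    AnalyticAt.clm_comp (AnalyticAt.fun_comp (by rw [hΦ0]; exact hS.fderiv) hΦan) analyticAt_const
  have hXΨ : ∀ᶠ s in 𝓝 0, ∀ w, fderiv ℂ Ψ s (X s w) = 0 := by
    have h1 : ∀ᶠ s in 𝓝 0, AnalyticAt ℂ Φ.symm (Φ s) :=
      hΦan.continuousAt.eventually (by rw [hΦ0]; exact hS.eventually_analyticAt)
    filter_upwards [h1, hΨ.eventually_analyticAt, Φ.open_source.mem_nhds h0Φ] with s hs1 hs2 hs3 w
    have h2 : HasFDerivAt (fun y => Ψ (Φ.symm y))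
        ((fderiv ℂ Ψ s).comp (fderiv ℂ Φ.symm (Φ s))) (Φ s) := by
      refine HasFDerivAt.comp (g := Ψ) (Φ s) ?_ hs1.differentiableAt.hasFDerivAt
      rw [Φ.left_inv hs3]
      exact hs2.differentiableAt.hasFDerivAt
    have h3 : HasFDerivAt (fun y => Ψ (Φ.symm y))
        (ContinuousLinearMap.fst ℂ (CSpace N) K) (Φ s) := by
      refine hasFDerivAt_fst.congr_of_eventuallyEq ?_
      filter_upwards [Φ.open_target.mem_nhds (Φ.map_source hs3)] with y hy
      have := congrArg Prod.fst (Φ.right_inv hy)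
      rwa [hΦ] at this
    exact DFunLike.congr_fun (h2.unique h3) (0, w)
  have hreal : Filter.Tendsto (realPoint d) (𝓝 0) (𝓝 0) := by
    simpa using (realPoint d).continuous.tendsto 0
  have hCR' := hCR.eventually_fderiv_eq_zero hf.differentiableOn hψ hρ hψ0 hρp hpar hMρ hfg
    (X := fun t w => X (realPoint d t) w)
    ((hreal.eventually hX.eventually_analyticAt).mono fun t ht w =>
      (ht.clm_apply analyticAt_const).restrictScalars.fun_comp ((realPoint d).analyticAt t))
    (by
      filter_upwards [hdΨ, hreal.eventually hXΨ] with t ht1 ht2 w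
      rw [← ht1, ht2])
  have hdhX : ∀ᶠ s in 𝓝 0, (fderiv ℂ h s).comp (X s) = 0 := by
    refine eventually_eq_zero_of_realPoint (hh.fderiv.clm_comp hX) ?_
    filter_upwards [hdh, hCR'] with t ht1 ht2
    ext w
    rw [ContinuousLinearMap.comp_apply, ht1, ht2]
    rfl
  have hK : ∀ᶠ y in 𝓝 (p, (0 : K)), h (Φ.symm y) = h (Φ.symm (y.1, 0)) := by
    refine eventually_eq_of_fderiv_comp_inr_eq_zero (K := fun y => h (Φ.symm y)) ?_
    have hSt : Filter.Tendsto Φ.symm (𝓝 (p, (0 : K))) (𝓝 0) := by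
      simpa only [hS0] using hS.continuousAt.tendsto
    filter_upwards [hSt.eventually hdhX, hSt.eventually hh.eventually_analyticAt,
      hS.eventually_analyticAt, Φ.open_target.mem_nhds (hΦ0 ▸ Φ.map_source h0Φ)]
      with y hy1 hy2 hy3 hy4
    have h1 : HasFDerivAt (fun y => h (Φ.symm y))
        ((fderiv ℂ h (Φ.symm y)).comp (fderiv ℂ Φ.symm y)) y :=
      hy2.differentiableAt.hasFDerivAt.comp y hy3.differentiableAt.hasFDerivAt
    refine ⟨h1.differentiableAt, fun w => ?_⟩
    rw [h1.fderiv]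
    have h2 := DFunLike.congr_fun hy1 w
    simp only [X, Φ.right_inv hy4] at h2
    exact h2
  have hι : AnalyticAt ℂ (fun x : CSpace N => (x, (0 : K))) p := analyticAt_id.prod analyticAt_const
  -- F evaluates h at one chosen point of the fibre over x. For x in M the real point ρ x lies in
  -- the same fibre, and there h equals f x.
  refine ⟨fun x => h (Φ.symm (x, 0)), ?_, ?_⟩
  · exact AnalyticAt.fun_comp (g := h) (by rw [hS0]; exact hh) (AnalyticAt.fun_comp hS hι)
  · have hρt : Filter.Tendsto ρ (𝓝 p) (𝓝 0) := by simpa only [hρp] using hρ.continuousAt.tendsto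
    have hι' : Filter.Tendsto (fun x => (x, π (realPoint d (ρ x)))) (𝓝 p) (𝓝 (p, (0 : K))) := by
      refine Filter.tendsto_id.prodMk_nhds ?_
      have := (π.continuous.tendsto 0).comp (hreal.comp hρt)
      rwa [map_zero] at this
    filter_upwards [hMρ, hι'.eventually hK, hρt.eventually hΨψ, hρt.eventually hhg,
      hρt.eventually (hreal.eventually (Φ.open_source.mem_nhds h0Φ))] with x hx1 hx2 hx3 hx4 hx5 hxM
    have h1 : Φ (realPoint d (ρ x)) = (x, π (realPoint d (ρ x))) := by
      rw [hΦ, sub_zero]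
      exact Prod.ext (hx3.trans (hx1 hxM)) rfl
    rw [← hx2, ← h1, Φ.left_inv hx5]
    refine hx4.trans ?_
    rw [hx1 hxM]
    exact (hfg₀ (Set.mem_insert_of_mem _ hxM)).symm

/-! ### The converse, and gluing -/

theorem isCRFunction_of_holomorphic_extension {N : ℕ} {M U : Set (CSpace N)} {f F : CSpace N → ℂ}
    (hf : DifferentiableOn ℝ f M) (hU : IsOpen U) (hMU : M ⊆ U) (hF : DifferentiableOn ℂ F U)
    (hFf : ∀ q ∈ M, F q = f q) : IsCRFunction M f := by
  rintro V L - hL q hq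
  have hFq := ((hF q (hMU hq.1)).differentiableAt (hU.mem_nhds (hMU hq.1))).hasFDerivAt
  have hT : ∀ v ∈ realTangent M q, fderivWithin ℝ f M q v = fderiv ℂ F q v := by
    intro v hv
    have h1 : HasFDerivWithinAt (fun x => f x - F x)
        (fderivWithin ℝ f M q - (fderiv ℂ F q).restrictScalars ℝ) M q :=
      (hf q hq.1).hasFDerivWithinAt.sub (hFq.restrictScalars ℝ).hasFDerivWithinAt
    exact sub_eq_zero.1 (fderiv_apply_eq_zero_of_realTangent h1
      (.of_forall fun x hx => sub_eq_zero.2 (hFf x hx).symm) hv)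
  obtain ⟨⟨Y, hY⟩, hLT⟩ := hL.2 q hq
  have hle : (realTangent M q).baseChange ℂ ≤ LinearMap.eqLocus
      (LinearMap.liftBaseChange ℂ (fderivWithin ℝ f M q : CSpace N →ₗ[ℝ] ℂ))
      (LinearMap.liftBaseChange ℂ ((fderiv ℂ F q).restrictScalars ℝ : CSpace N →ₗ[ℝ] ℂ)) := by
    rw [Submodule.baseChange_eq_span, Submodule.span_le]
    rintro _ ⟨v, hv, rfl⟩
    simpa using hT v hv
  have h2 : derivAlong M f q (L q) =
      LinearMap.liftBaseChange ℂ ((fderiv ℂ F q).restrictScalars ℝ : CSpace N →ₗ[ℝ] ℂ) (L q) :=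
    hle hLT
  rw [h2, ← hY]
  -- dF(Y) + i dF(iY) = dF(Y) - dF(Y) = 0.
  simp [antiholVector, complexStructure, ← mul_assoc]

/-- The intersection is convex and contains the point q of M, near which G = H by uniqueness; the
identity theorem does the rest. -/
theorem eqOn_ball_inter_ball_of_generic {N : ℕ} {M : Set (CSpace N)} (hgen : IsCRGeneric M)
    {f G H : CSpace N → ℂ} {p q : CSpace N} {r s : ℝ} (hq : q ∈ M) (hs : 0 < s)
    (hqp : q ∈ Metric.ball p r)
    (hG : AnalyticOnNhd ℂ G (Metric.ball p r)) (hH : AnalyticOnNhd ℂ H (Metric.ball q s))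
    (hGf : ∀ x ∈ Metric.ball p r, x ∈ M → G x = f x)
    (hHf : ∀ x ∈ Metric.ball q s, x ∈ M → H x = f x) :
    Set.EqOn G H (Metric.ball p r ∩ Metric.ball q s) := by
  have hqq := Metric.mem_ball_self (x := q) hs
  refine (hG.mono Set.inter_subset_left).eqOn_of_preconnected_of_eventuallyEq
    (hH.mono Set.inter_subset_right)
    ((convex_ball p r).inter (convex_ball q s)).isPreconnected ⟨hqp, hqq⟩ ?_
  have h1 : ∀ᶠ x in 𝓝 q, G x - H x = 0 := by
    refine eventually_eq_zero_of_generic hq (.of_forall hgen) ((hG q hqp).sub (hH q hqq)) ?_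
    filter_upwards [Metric.isOpen_ball.mem_nhds hqp, Metric.isOpen_ball.mem_nhds hqq]
      with x hx1 hx2 hxM
    rw [hGf x hx1 hxM, hHf x hx2 hxM, sub_self]
  exact h1.mono fun x hx => sub_eq_zero.1 hx

/-- Local holomorphic extensions of a function on a generic set glue to a holomorphic extension
on a neighborhood. -/
theorem exists_holomorphic_extension_of_local {N : ℕ} {M : Set (CSpace N)} (hgen : IsCRGeneric M)
    {f : CSpace N → ℂ}
    (hloc : ∀ p ∈ M, ∃ F : CSpace N → ℂ, AnalyticAt ℂ F p ∧ ∀ᶠ x in 𝓝 p, x ∈ M → F x = f x) :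
    ∃ (U : Set (CSpace N)) (F : CSpace N → ℂ),
      IsOpen U ∧ M ⊆ U ∧ DifferentiableOn ℂ F U ∧ ∀ q ∈ M, F q = f q := by
  have hball : ∀ p : M, ∃ (F : CSpace N → ℂ) (r : ℝ), 0 < r ∧
      AnalyticOnNhd ℂ F (Metric.ball p r) ∧ ∀ x ∈ Metric.ball (p : CSpace N) r, x ∈ M → F x = f x := by
    rintro ⟨p, hp⟩
    obtain ⟨F, hF, hFf⟩ := hloc p hp
    obtain ⟨r, hr, h⟩ := Metric.eventually_nhds_iff_ball.1 (hF.eventually_analyticAt.and hFf)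
    exact ⟨F, r, hr, fun x hx => (h x hx).1, fun x hx => (h x hx).2⟩
  choose F r hr hF hFf using hball
  have hsub : ∀ p : M, Metric.ball (p : CSpace N) (r p / 3) ⊆ Metric.ball p (r p) := fun p =>
    Metric.ball_subset_ball (by linarith [hr p])
  -- Shrinking the radii to a third forces dist q p < 2 r p / 3 when the small balls meet, so the
  -- larger full ball contains the other center.
  have hcompat' : ∀ p q : M, r q ≤ r p → ∀ x ∈ Metric.ball (p : CSpace N) (r p / 3),
      x ∈ Metric.ball (q : CSpace N) (r q / 3) → F p x = F q x := by
    intro p q hle x hxp hxq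
    refine eqOn_ball_inter_ball_of_generic hgen q.2 (hr q) ?_ (hF p) (hF q) (hFf p) (hFf q)
      ⟨hsub p hxp, hsub q hxq⟩
    rw [Metric.mem_ball] at hxp hxq ⊢
    linarith [dist_triangle_left (q : CSpace N) p x, hr p]
  have hcompat : ∀ p q : M, ∀ x ∈ Metric.ball (p : CSpace N) (r p / 3),
      x ∈ Metric.ball (q : CSpace N) (r q / 3) → F p x = F q x := by
    intro p q x hxp hxq
    rcases le_total (r q) (r p) with hle | hle
    · exact hcompat' p q hle x hxp hxq
    · exact (hcompat' q p hle x hxq hxp).symm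
  classical
  let G : CSpace N → ℂ := fun x =>
    if h : ∃ p : M, x ∈ Metric.ball (p : CSpace N) (r p / 3) then F h.choose x else 0
  have hG : ∀ p : M, Set.EqOn G (F p) (Metric.ball (p : CSpace N) (r p / 3)) := by
    intro p x hx
    have h : ∃ p : M, x ∈ Metric.ball (p : CSpace N) (r p / 3) := ⟨p, hx⟩
    simp only [G, dif_pos h]
    exact hcompat _ _ x h.choose_spec hx
  have hself : ∀ p : M, (p : CSpace N) ∈ Metric.ball (p : CSpace N) (r p / 3) := fun p =>
    Metric.mem_ball_self (by linarith [hr p])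
  refine ⟨⋃ p : M, Metric.ball (p : CSpace N) (r p / 3), G,
    isOpen_iUnion fun _ => Metric.isOpen_ball, fun p hp => Set.mem_iUnion.2 ⟨⟨p, hp⟩, hself ⟨p, hp⟩⟩,
    fun x hx => ?_, fun q hq => ?_⟩
  · obtain ⟨p, hxp⟩ := Set.mem_iUnion.1 hx
    refine DifferentiableAt.differentiableWithinAt ?_
    exact (hF p x (hsub p hxp)).differentiableAt.congr_of_eventuallyEq
      ((hG p).eventuallyEq_of_mem (Metric.isOpen_ball.mem_nhds hxp))
  · rw [hG ⟨q, hq⟩ (hself ⟨q, hq⟩)]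
    exact hFf ⟨q, hq⟩ q (Metric.mem_ball_self (hr _)) hq

theorem mainTheorem5 (n c : ℕ) (M : Set (CSpace (n + c)))
    (hM : IsAnalyticSubmanifold c M) (hgen : IsCRGeneric M)
    (f : CSpace (n + c) → ℂ) (hf : AnalyticOn ℝ f M) :
    IsCRFunction M f ↔
      ∃ (U : Set (CSpace (n + c))) (F : CSpace (n + c) → ℂ),
        IsOpen U ∧ M ⊆ U ∧ DifferentiableOn ℂ F U ∧ ∀ q ∈ M, F q = f q := by
  refine ⟨fun hCR => exists_holomorphic_extension_of_local hgen fun p hp =>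
    hCR.exists_local_extension hM hgen hf hp, ?_⟩
  rintro ⟨U, F, hU, hMU, hF, hFf⟩
  exact isCRFunction_of_holomorphic_extension hf.differentiableOn hU hMU hF hFf
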